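/- Let $\gamma_1,\gamma_2,V_1,V_2>0$ and let $g_1,g_2:[0,\infty)\to[0,\infty)$ be Lipschitz continuous functions that are either both non-decreasing or both non-increasing, at least one of them being bounded. Let $N$ be the number of compartments and let $a_{ij}\ge 0$ with $a_{ij}=a_{ji}$ for $i,j=1,\dots,N$. Consider the network $$\dot x_{1,i}=-\gamma_1x_{1,i}+V_1g_2(x_{2,i})+\sum_{j=1}^N a_{ij}(x_{1,j}-x_{1,i}),\qquad \dot x_{2,i}=-\gamma_2x_{2,i}+V_2g_1(x_{1,i}),\qquad i=1,\dots,N,$$ on the nonnegative orthant. Let $\bar x_1,\bar x_2\ge 0$ be such that $\mathcal B=[0,\bar x_1]\times[0,\bar x_2]$ is forward invariant for the isolated compartment $\dot x_1=-\gamma_1x_1+V_1g_2(x_2)$, $\dot x_2=-\gamma_2x_2+V_2g_1(x_1)$ on $[0,\infty)^2$. Then, for every $\xi\in\mathcal B^N$, the network has a unique solution $x:[0,\infty)\to[0,\infty)^{2N}$ with $x(0)=\xi$; this solution stays in $\mathcal B^N$, and its $\omega$-limit set $$\omega(\xi)=\{p:\ x(t_n)\to p\text{ for some sequence }t_n\to+\infty\}$$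 consists only of equilibria of the network. If, moreover, the equilibria of the network in $\mathcal B^N$ are isolated (that is, they form a discrete subspace), then for every $\xi\in\mathcal B^N$ the solution $x(t)$ converges, as $t\to+\infty$, to a single equilibrium of the network. -/

import Mathlib

open Set Filter Topology

namespace BistableNetwork

/-- The data of one compartment: rates `γ₁, γ₂`, synthesis rates `V₁, V₂`, and the regulation
functions `g₁, g₂`. Only the values of `g₁, g₂` on `[0, ∞)` are ever meaningful. -/
structure Compartment where
  γ₁ : ℝ
  γ₂ : ℝ
  V₁ : ℝ
  V₂ : ℝ
  g₁ : ℝ → ℝ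
  g₂ : ℝ → ℝ

/-- Standing assumptions: the constants are positive; on `[0, ∞)` the functions `g₁, g₂` are
nonnegative, Lipschitz, both non-decreasing or both non-increasing, and at least one of them is
bounded. -/
structure Compartment.IsAdmissible (c : Compartment) : Prop where
  γ₁_pos : 0 < c.γ₁
  γ₂_pos : 0 < c.γ₂
  V₁_pos : 0 < c.V₁
  V₂_pos : 0 < c.V₂
  g₁_nonneg : ∀ s, 0 ≤ s → 0 ≤ c.g₁ s
  g₂_nonneg : ∀ s, 0 ≤ s → 0 ≤ c.g₂ s
  g₁_lipschitz : ∃ K, LipschitzOnWith K c.g₁ (Ici 0)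
  g₂_lipschitz : ∃ K, LipschitzOnWith K c.g₂ (Ici 0)
  monotone : (MonotoneOn c.g₁ (Ici 0) ∧ MonotoneOn c.g₂ (Ici 0)) ∨
    (AntitoneOn c.g₁ (Ici 0) ∧ AntitoneOn c.g₂ (Ici 0))
  bounded : BddAbove (c.g₁ '' Ici 0) ∨ BddAbove (c.g₂ '' Ici 0)

/-- The vector field of an isolated compartment, with state `(x₁, x₂)`. -/
def Compartment.field (c : Compartment) (x : ℝ × ℝ) : ℝ × ℝ :=
  (-c.γ₁ * x.1 + c.V₁ * c.g₂ x.2, -c.γ₂ * x.2 + c.V₂ * c.g₁ x.1)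

/-- The vector field of the network of `N` compartments in which the first species diffuses with
coupling coefficients `a i j`. The state of compartment `i` is `x i = (x₁ᵢ, x₂ᵢ)`. -/
def Compartment.networkField (c : Compartment) {N : ℕ} (a : Fin N → Fin N → ℝ)
    (x : Fin N → ℝ × ℝ) : Fin N → ℝ × ℝ := fun i =>
  (-c.γ₁ * (x i).1 + c.V₁ * c.g₂ (x i).2 + ∑ j, a i j * ((x j).1 - (x i).1),
    -c.γ₂ * (x i).2 + c.V₂ * c.g₁ (x i).1)

/-- `x` is a solution on `[0, ∞)` of `x' = f(x)`, `x 0 = ξ`, where `f` is regarded as a vector field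
on the domain `D` only. The values of `x` at negative times are irrelevant. -/
structure IsSolution {E : Type*} [NormedAddCommGroup E] [NormedSpace ℝ E]
    (f : E → E) (D : Set E) (ξ : E) (x : ℝ → E) : Prop where
  init : x 0 = ξ
  mem : ∀ t, 0 ≤ t → x t ∈ D
  ode : IsIntegralCurveOn x (fun _ => f) (Ici 0)

/-- Every solution in `D` that starts in `S` stays in `S`. -/
def ForwardInvariant {E : Type*} [NormedAddCommGroup E] [NormedSpace ℝ E]
    (f : E → E) (D S : Set E) : Prop :=
  ∀ ξ ∈ S, ∀ x : ℝ → E, IsSolution f D ξ x → ∀ t, 0 ≤ t → x t ∈ S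

/-- The box `B = [0, b₁] × [0, b₂]`. -/
def box (b₁ b₂ : ℝ) : Set (ℝ × ℝ) := Icc 0 b₁ ×ˢ Icc 0 b₂

/-- The box `B^N`. -/
def boxN (N : ℕ) (b₁ b₂ : ℝ) : Set (Fin N → ℝ × ℝ) := {x | ∀ i, x i ∈ box b₁ b₂}

/-- The equilibria, in the nonnegative orthant, of the network. -/
def Compartment.equilibria (c : Compartment) {N : ℕ} (a : Fin N → Fin N → ℝ) :
    Set (Fin N → ℝ × ℝ) :=
  {x | 0 ≤ x ∧ c.networkField a x = 0}

/-- The `ω`-limit set of a curve: its cluster points as `t → ∞`. -/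
def omegaLimitSet {E : Type*} [TopologicalSpace E] (x : ℝ → E) : Set E :=
  {p | MapClusterPt p atTop x}

end BistableNetwork

namespace BistableNetwork

/-! ### Existence, uniqueness and one-sided barriers for autonomous equations -/

section ODE

variable {E : Type*} [NormedAddCommGroup E] [NormedSpace ℝ E]

/-! Invariance of the box for one compartment forces its field to point inwards on the upper faces.
Diffusion keeps this property, since a coordinate at an extreme value can only be pulled back by the
others. So the network has a solution in `boxN`, and uniqueness follows from the Lipschitz bound.

Convergence rests on a Lyapunov function. Since `a` is symmetric, the linear part of the first
equation is minus the gradient of a quadratic form in the first species. The feedback through the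
second species is handled by a storage function `Φ`: with `m = V₂ / γ₂ * g₁`, moving `s` towards `m
u` changes `Φ s` by at most `u` times the change of `g₂ s` (`exists_storage`). Adding `V₁ * (Φ x₂ -
x₁ * g₂ x₂)` over the compartments gives an energy whose upper right derivative is at most `-∑
(x₁ᵢ')²` (`frequently_slope_energy_lt`). The functions `g₁, g₂` need not be differentiable, hence
slopes instead of derivatives.

A Barbalat argument gives `x₁ᵢ' → 0`. The second species then relaxes to the slowly varying target
`m x₁ᵢ`, so `x₂ᵢ' → 0` too. The field therefore vanishes on the ω-limit set, and a trajectory in a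
compact set cannot wander among isolated limit points. -/

theorem eqOn_Ici_of_isIntegralCurveOn {f : E → E} {D : Set E} {K : NNReal}
    (hf : LipschitzOnWith K f D) {x y : ℝ → E}
    (hx : IsIntegralCurveOn x (fun _ => f) (Ici 0)) (hxD : ∀ t, 0 ≤ t → x t ∈ D)
    (hy : IsIntegralCurveOn y (fun _ => f) (Ici 0)) (hyD : ∀ t, 0 ≤ t → y t ∈ D)
    (h0 : x 0 = y 0) : EqOn x y (Ici 0) := by
  intro t ht
  exact ODE_solution_unique_of_mem_Icc_right (v := fun _ => f) (s := fun _ => D) (K := K)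
    (fun _ _ => hf) (hx.continuousOn.mono Icc_subset_Ici_self)
    (fun s hs => (hx s hs.1).mono (Ici_subset_Ici.2 hs.1)) (fun s hs => hxD s hs.1)
    (hy.continuousOn.mono Icc_subset_Ici_self)
    (fun s hs => (hy s hs.1).mono (Ici_subset_Ici.2 hs.1)) (fun s hs => hyD s hs.1) h0
    (right_mem_Icc.2 ht)

theorem exists_isIntegralCurveOn_Ici_of_bounded [CompleteSpace E] {f : E → E} {K L : NNReal}
    (hf : LipschitzWith K f) (hL : ∀ x, ‖f x‖ ≤ L) (ξ : E) :
    ∃ x : ℝ → E, x 0 = ξ ∧ IsIntegralCurveOn x (fun _ => f) (Ici 0) := by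
  have hloc : ∀ n : ℕ, ∃ α : ℝ → E, α 0 = ξ ∧
      ∀ t ∈ Icc (0 : ℝ) n, HasDerivWithinAt α (f (α t)) (Icc (0 : ℝ) n) t := by
    intro n
    have h0 : (0 : ℝ) ∈ Icc (0 : ℝ) n := ⟨le_rfl, n.cast_nonneg⟩
    -- The bound `L` on the speed is global, so the ball of radius `L * n` cannot be left before
    -- time `n`.
    have hPL : IsPicardLindelof (fun _ => f) (⟨0, h0⟩ : Icc (0 : ℝ) n) ξ (L * n) 0 L K := by
      refine IsPicardLindelof.of_time_independent (fun x _ => hL x) hf.lipschitzOnWith ?_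
      simp
    exact hPL.exists_eq_forall_mem_Icc_hasDerivWithinAt₀
  choose α hα0 hα using hloc
  have hagree : ∀ m n : ℕ, m ≤ n → EqOn (α m) (α n) (Icc (0 : ℝ) m) := by
    intro m n hmn
    have key : ∀ k : ℕ, m ≤ k → ContinuousOn (α k) (Icc (0 : ℝ) m) ∧
        ∀ t ∈ Ico (0 : ℝ) m, HasDerivWithinAt (α k) (f (α k t)) (Ici t) t := by
      intro k hk
      have hk' : (m : ℝ) ≤ k := Nat.cast_le.2 hk
      refine ⟨fun t ht => ((hα k t ⟨ht.1, ht.2.trans hk'⟩).continuousWithinAt).mono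
        (Icc_subset_Icc_right hk'), fun t ht => ?_⟩
      have htk : t < k := ht.2.trans_le hk'
      exact (hα k t ⟨ht.1, htk.le⟩).mono_of_mem_nhdsWithin
        (mem_of_superset (Icc_mem_nhdsGE htk) (Icc_subset_Icc_left ht.1))
    exact ODE_solution_unique_of_mem_Icc_right (v := fun _ => f) (s := fun _ => univ) (K := K)
      (fun _ _ => hf.lipschitzOnWith) (key m le_rfl).1 (key m le_rfl).2 (fun _ _ => mem_univ _)
      (key n hmn).1 (key n hmn).2 (fun _ _ => mem_univ _) ((hα0 m).trans (hα0 n).symm)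
  -- The index `⌊t⌋₊ + 1` is the least natural number strictly above `t`.
  have hx : ∀ n : ℕ, EqOn (fun t => α (⌊t⌋₊ + 1) t) (α n) (Ico (0 : ℝ) n) := by
    intro n t ht
    refine hagree _ n ?_ ⟨ht.1, ?_⟩
    · exact Nat.succ_le_of_lt ((Nat.floor_lt ht.1).2 ht.2)
    · exact_mod_cast (Nat.lt_floor_add_one t).le
  refine ⟨fun t => α (⌊t⌋₊ + 1) t, by simp [hα0], fun t ht => ?_⟩
  obtain ⟨n, hn⟩ := exists_nat_gt t
  have htn : t ∈ Ico (0 : ℝ) n := ⟨ht, hn⟩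
  have hmem : Ico (0 : ℝ) n ∈ 𝓝[Ici 0] t := by
    rw [← Ici_inter_Iio]
    exact inter_mem self_mem_nhdsWithin (mem_nhdsWithin_of_mem_nhds (Iio_mem_nhds hn))
  have hd : HasDerivWithinAt (α n) (f (α n t)) (Ici 0) t :=
    (hα n t ⟨ht, hn.le⟩).mono_of_mem_nhdsWithin (mem_of_superset hmem Ico_subset_Icc_self)
  have := hd.congr_of_eventuallyEq (mem_of_superset hmem (hx n)) (hx n htn)
  rwa [← hx n htn] at this

/-- The barrier `b + ε * (s + 1)` lies strictly above `b` from the start and has slope `ε > 0`, so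
`y` cannot cross it; then `ε → 0`. -/
theorem le_of_deriv_nonpos_above {y y' : ℝ → ℝ} {b : ℝ}
    (hy : ∀ t, 0 ≤ t → HasDerivWithinAt y (y' t) (Ici 0) t) (h0 : y 0 ≤ b)
    (h : ∀ t, 0 ≤ t → b < y t → y' t ≤ 0) {t : ℝ} (ht : 0 ≤ t) : y t ≤ b := by
  have key : ∀ ε : ℝ, 0 < ε → y t ≤ b + ε * (t + 1) := by
    intro ε hε
    refine image_le_of_deriv_right_lt_deriv_boundary (f := y) (f' := y') (a := 0) (b := t)
      (B := fun s => b + ε * (s + 1)) (B' := fun _ => ε)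
      (fun s hs => ((hy s hs.1).continuousWithinAt).mono Icc_subset_Ici_self)
      (fun s hs => (hy s hs.1).mono (Ici_subset_Ici.2 hs.1)) (by simp; linarith) ?_ ?_
      (right_mem_Icc.2 ht)
    · intro s
      simpa using (((hasDerivAt_id s).add_const 1).const_mul ε).const_add b
    · intro s hs hsb
      have : 0 < ε * (s + 1) := mul_pos hε (by linarith [hs.1])
      exact (h s hs.1 (by rw [hsb]; linarith)).trans_lt hε
  refine le_of_forall_pos_le_add fun ε hε => ?_
  have := key (ε / (t + 1)) (by positivity)
  rwa [div_mul_cancel₀ _ (by positivity)] at this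

theorem ge_of_deriv_nonneg_below {y y' : ℝ → ℝ} {b : ℝ}
    (hy : ∀ t, 0 ≤ t → HasDerivWithinAt y (y' t) (Ici 0) t) (h0 : b ≤ y 0)
    (h : ∀ t, 0 ≤ t → y t < b → 0 ≤ y' t) {t : ℝ} (ht : 0 ≤ t) : b ≤ y t := by
  have := le_of_deriv_nonpos_above (y := fun t => -y t) (y' := fun t => -y' t) (b := -b)
    (fun t ht => (hy t ht).neg) (neg_le_neg h0)
    (fun t ht hb => neg_nonpos.2 (h t ht (neg_lt_neg_iff.1 hb))) ht
  exact neg_le_neg_iff.1 this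

end ODE

/-! ### Solutions of the network in the box, and inward pointing fields -/

section Network

variable {N : ℕ}

theorem hasDerivWithinAt_coord {x : ℝ → Fin N → ℝ × ℝ} {x' : Fin N → ℝ × ℝ} {s : Set ℝ} {t : ℝ}
    (h : HasDerivWithinAt x x' s t) (i : Fin N) :
    HasDerivWithinAt (fun t => (x t i).1) (x' i).1 s t ∧
      HasDerivWithinAt (fun t => (x t i).2) (x' i).2 s t := by
  have hi := (hasDerivWithinAt_pi.1 h) i
  have hi' := hi.hasFDerivWithinAt
  have h1 := hi'.fst.hasDerivWithinAt
  have h2 := hi'.snd.hasDerivWithinAt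
  simp at h1 h2
  exact ⟨h1, h2⟩

theorem boxN_subset_Ici {b₁ b₂ : ℝ} : boxN N b₁ b₂ ⊆ Ici 0 :=
  fun _ hx i => ⟨(hx i).1.1, (hx i).2.1⟩

theorem isCompact_boxN (b₁ b₂ : ℝ) : IsCompact (boxN N b₁ b₂) := by
  have : boxN N b₁ b₂ = Set.pi univ fun _ => box b₁ b₂ := by
    ext x; simp [boxN]
  rw [this]
  exact isCompact_univ_pi fun _ => isCompact_Icc.prod isCompact_Icc

theorem dist_fst_apply_le (x y : Fin N → ℝ × ℝ) (i : Fin N) :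
    |(x i).1 - (y i).1| ≤ dist x y :=
  (le_max_left _ _).trans (dist_le_pi_dist x y i)

theorem dist_snd_apply_le (x y : Fin N → ℝ × ℝ) (i : Fin N) :
    |(x i).2 - (y i).2| ≤ dist x y :=
  (le_max_right _ _).trans (dist_le_pi_dist x y i)

theorem Compartment.IsAdmissible.exists_lipschitzOnWith_networkField {c : Compartment}
    (hc : c.IsAdmissible) (a : Fin N → Fin N → ℝ) :
    ∃ K, LipschitzOnWith K (c.networkField a) (Ici 0) := by
  obtain ⟨K₁, h₁⟩ := hc.g₁_lipschitz
  obtain ⟨K₂, h₂⟩ := hc.g₂_lipschitz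
  have hγ₁ := hc.γ₁_pos
  have hγ₂ := hc.γ₂_pos
  have hV₁ := hc.V₁_pos
  have hV₂ := hc.V₂_pos
  let A : Fin N → ℝ := fun i => ∑ j, |a i j| * 2
  have hA : ∀ i, 0 ≤ A i := fun i => Finset.sum_nonneg fun j _ => by positivity
  have hA' : ∀ i, A i ≤ ∑ i, A i := fun i =>
    Finset.single_le_sum (fun j _ => hA j) (Finset.mem_univ i)
  have hA0 : 0 ≤ ∑ i, A i := Finset.sum_nonneg fun i _ => hA i
  let C : ℝ := c.γ₁ + c.V₁ * K₂ + ∑ i, A i + c.γ₂ + c.V₂ * K₁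
  have hC : 0 ≤ C := by positivity
  refine ⟨C.toNNReal, LipschitzOnWith.of_dist_le_mul fun x hx y hy => ?_⟩
  rw [Real.coe_toNNReal _ hC]
  have hd : 0 ≤ dist x y := dist_nonneg
  refine (dist_pi_le_iff (by positivity)).2 fun i => ?_
  have e1 := dist_fst_apply_le x y i
  have e2 := dist_snd_apply_le x y i
  have e3 : |c.g₁ (x i).1 - c.g₁ (y i).1| ≤ K₁ * dist x y :=
    (h₁.dist_le_mul _ (hx i).1 _ (hy i).1).trans (by gcongr; exact e1)
  have e4 : |c.g₂ (x i).2 - c.g₂ (y i).2| ≤ K₂ * dist x y :=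
    (h₂.dist_le_mul _ (hx i).2 _ (hy i).2).trans (by gcongr; exact e2)
  have e5 : |∑ j, a i j * ((x j).1 - (x i).1) - ∑ j, a i j * ((y j).1 - (y i).1)|
      ≤ (∑ i, A i) * dist x y := by
    rw [← Finset.sum_sub_distrib]
    refine (Finset.abs_sum_le_sum_abs _ _).trans
      (le_trans ?_ (mul_le_mul_of_nonneg_right (hA' i) hd))
    rw [Finset.sum_mul]
    refine Finset.sum_le_sum fun j _ => ?_
    rw [← mul_sub, abs_mul, mul_assoc]
    refine mul_le_mul_of_nonneg_left ?_ (abs_nonneg _)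
    have := dist_fst_apply_le x y j
    rw [abs_le] at *
    constructor <;> linarith
  have hγd₁ : 0 ≤ c.γ₁ * dist x y := by positivity
  have hγd₂ : 0 ≤ c.γ₂ * dist x y := by positivity
  have hVd₁ : 0 ≤ c.V₁ * (K₂ * dist x y) := by positivity
  have hVd₂ : 0 ≤ c.V₂ * (K₁ * dist x y) := by positivity
  have hAd : 0 ≤ (∑ i, A i) * dist x y := by positivity
  have hCd : C * dist x y = c.γ₁ * dist x y + c.V₁ * (K₂ * dist x y) + (∑ i, A i) * dist x y +
    c.γ₂ * dist x y + c.V₂ * (K₁ * dist x y) := by simp only [C]; ring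
  have m1 := mul_le_mul_of_nonneg_left e1 hγ₁.le
  have m2 := mul_le_mul_of_nonneg_left e2 hγ₂.le
  have m3 := mul_le_mul_of_nonneg_left e3 hV₂.le
  have m4 := mul_le_mul_of_nonneg_left e4 hV₁.le
  rw [← abs_of_pos hγ₁, ← abs_mul, abs_of_pos hγ₁] at m1
  rw [← abs_of_pos hγ₂, ← abs_mul, abs_of_pos hγ₂] at m2
  rw [← abs_of_pos hV₂, ← abs_mul, abs_of_pos hV₂] at m3
  rw [← abs_of_pos hV₁, ← abs_mul, abs_of_pos hV₁] at m4
  refine max_le ?_ ?_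
  · rw [Real.dist_eq, hCd]
    simp only [Compartment.networkField]
    rw [abs_le] at *
    constructor <;> linarith
  · rw [Real.dist_eq, hCd]
    simp only [Compartment.networkField]
    rw [abs_le] at *
    constructor <;> linarith

/-- The coordinatewise projection onto `boxN N b₁ b₂`. -/
def clamp (N : ℕ) (b₁ b₂ : ℝ) (x : Fin N → ℝ × ℝ) : Fin N → ℝ × ℝ :=
  fun i => (max 0 (min b₁ (x i).1), max 0 (min b₂ (x i).2))

theorem lipschitzWith_clamp (b₁ b₂ : ℝ) : LipschitzWith 1 (clamp N b₁ b₂) := by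
  refine LipschitzWith.of_dist_le_mul fun x y => ?_
  rw [NNReal.coe_one, one_mul]
  have key : ∀ b s t : ℝ, |max 0 (min b s) - max 0 (min b t)| ≤ |s - t| := fun b s t =>
    (abs_max_sub_max_le_max _ _ _ _).trans (by
      simpa using (abs_min_sub_min_le_max b s b t))
  exact (dist_pi_le_iff dist_nonneg).2 fun i => max_le
    ((key _ _ _).trans (dist_fst_apply_le x y i)) ((key _ _ _).trans (dist_snd_apply_le x y i))

theorem clamp_mem {b₁ b₂ : ℝ} (hb₁ : 0 ≤ b₁) (hb₂ : 0 ≤ b₂) (x : Fin N → ℝ × ℝ) :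
    clamp N b₁ b₂ x ∈ boxN N b₁ b₂ := fun _ =>
  ⟨⟨le_max_left _ _, max_le hb₁ (min_le_left _ _)⟩, ⟨le_max_left _ _, max_le hb₂ (min_le_left _ _)⟩⟩

theorem clamp_of_mem {b₁ b₂ : ℝ} {x : Fin N → ℝ × ℝ} (hx : x ∈ boxN N b₁ b₂) :
    clamp N b₁ b₂ x = x := by
  funext i
  have h := hx i
  simp only [clamp]
  rw [min_eq_right h.1.2, max_eq_right h.1.1, min_eq_right h.2.2, max_eq_right h.2.1]

/-- If the compartment field points inwards along the upper faces of a box, the network has a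
solution that stays in the product of these boxes. -/
theorem Compartment.IsAdmissible.exists_isSolution_mem_boxN {c : Compartment}
    (hc : c.IsAdmissible) {a : Fin N → Fin N → ℝ} (ha : ∀ i j, 0 ≤ a i j) {b₁ b₂ : ℝ}
    (hb₁ : 0 ≤ b₁) (hb₂ : 0 ≤ b₂)
    (h₁ : ∀ s ∈ Icc 0 b₂, c.V₁ * c.g₂ s ≤ c.γ₁ * b₁)
    (h₂ : ∀ s ∈ Icc 0 b₁, c.V₂ * c.g₁ s ≤ c.γ₂ * b₂)
    {ξ : Fin N → ℝ × ℝ} (hξ : ξ ∈ boxN N b₁ b₂) :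
    ∃ x : ℝ → Fin N → ℝ × ℝ, IsSolution (c.networkField a) (Ici 0) ξ x ∧
      ∀ t, 0 ≤ t → x t ∈ boxN N b₁ b₂ := by
  obtain ⟨K, hK⟩ := hc.exists_lipschitzOnWith_networkField a
  -- Precomposing with `clamp` makes the field globally Lipschitz and bounded and does not change it
  -- on the box.
  have hlip : LipschitzWith K fun x => c.networkField a (clamp N b₁ b₂ x) := by
    have h : ∀ x, clamp N b₁ b₂ x ∈ Ici 0 := fun x => boxN_subset_Ici (clamp_mem hb₁ hb₂ x)
    refine LipschitzWith.of_dist_le_mul fun x y => (hK.dist_le_mul _ (h x) _ (h y)).trans ?_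
    gcongr
    simpa using (lipschitzWith_clamp b₁ b₂).dist_le_mul x y
  obtain ⟨L, hL⟩ := ((isCompact_boxN (N := N) b₁ b₂).image_of_continuousOn
    (hK.continuousOn.mono boxN_subset_Ici)).isBounded.exists_norm_le
  obtain ⟨x, hx0, hx⟩ := exists_isIntegralCurveOn_Ici_of_bounded (L := L.toNNReal) hlip
    (fun x => (hL _ (mem_image_of_mem _ (clamp_mem hb₁ hb₂ x))).trans (Real.le_coe_toNNReal L)) ξ
  have hd := fun t ht i => hasDerivWithinAt_coord (hx t ht) i
  have hmem : ∀ t, 0 ≤ t → x t ∈ boxN N b₁ b₂ := by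
    intro t ht i
    have hp := fun t j => clamp_mem hb₁ hb₂ (x t) j
    have hξi := hξ i
    rw [← hx0] at hξi
    refine ⟨⟨?_, ?_⟩, ⟨?_, ?_⟩⟩
    -- Outside a face, the clamped coordinate equals the extreme value, so every diffusion term has
    -- the inward sign.
    · refine ge_of_deriv_nonneg_below (fun t ht => (hd t ht i).1) hξi.1.1 (fun t ht hlt => ?_) ht
      have e : (clamp N b₁ b₂ (x t) i).1 = 0 := max_eq_left ((min_le_right _ _).trans hlt.le)
      have := mul_nonneg hc.V₁_pos.le (hc.g₂_nonneg _ (hp t i).2.1)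
      have hs : 0 ≤ ∑ j, a i j * ((clamp N b₁ b₂ (x t) j).1 - 0) :=
        Finset.sum_nonneg fun j _ => mul_nonneg (ha i j) (by simpa using (hp t j).1.1)
      simp only [Compartment.networkField, e]
      linarith
    · refine le_of_deriv_nonpos_above (fun t ht => (hd t ht i).1) hξi.1.2 (fun t ht hlt => ?_) ht
      have e : (clamp N b₁ b₂ (x t) i).1 = b₁ := by
        simp [clamp, min_eq_left hlt.le, hb₁]
      have := h₁ _ (hp t i).2
      have hs : ∑ j, a i j * ((clamp N b₁ b₂ (x t) j).1 - b₁) ≤ 0 :=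
        Finset.sum_nonpos fun j _ =>
          mul_nonpos_of_nonneg_of_nonpos (ha i j) (by simpa using (hp t j).1.2)
      simp only [Compartment.networkField, e]
      linarith
    · refine ge_of_deriv_nonneg_below (fun t ht => (hd t ht i).2) hξi.2.1 (fun t ht hlt => ?_) ht
      have e : (clamp N b₁ b₂ (x t) i).2 = 0 := max_eq_left ((min_le_right _ _).trans hlt.le)
      have := mul_nonneg hc.V₂_pos.le (hc.g₁_nonneg _ (hp t i).1.1)
      simp only [Compartment.networkField, e]
      linarith
    · refine le_of_deriv_nonpos_above (fun t ht => (hd t ht i).2) hξi.2.2 (fun t ht hlt => ?_) ht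
      have e : (clamp N b₁ b₂ (x t) i).2 = b₂ := by
        simp [clamp, min_eq_left hlt.le, hb₂]
      have := h₂ _ (hp t i).1
      simp only [Compartment.networkField, e]
      linarith
  refine ⟨x, ⟨hx0, fun t ht => boxN_subset_Ici (hmem t ht), fun t ht => ?_⟩, hmem⟩
  simpa only [clamp_of_mem (hmem t ht)] using hx t ht

/-- Isolated compartments have solutions starting from any point of the quadrant. -/
theorem Compartment.IsAdmissible.exists_isSolution_field {c : Compartment} (hc : c.IsAdmissible)
    {ξ : ℝ × ℝ} (hξ : 0 ≤ ξ) : ∃ x : ℝ → ℝ × ℝ, IsSolution c.field (Ici 0) ξ x := by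
  have hγ₁ := hc.γ₁_pos
  have hγ₂ := hc.γ₂_pos
  have hbox : ∃ b₁ b₂ : ℝ, ξ.1 ≤ b₁ ∧ ξ.2 ≤ b₂ ∧
      (∀ s ∈ Icc 0 b₂, c.V₁ * c.g₂ s ≤ c.γ₁ * b₁) ∧
      (∀ s ∈ Icc 0 b₁, c.V₂ * c.g₁ s ≤ c.γ₂ * b₂) := by
    have hstep : ∀ {γ V r M : ℝ}, 0 < γ → 0 < V → ∃ b, r ≤ b ∧ ∀ u ≤ M, V * u ≤ γ * b := by
      intro γ V r M hγ hV
      refine ⟨max r (V * M / γ), le_max_left _ _, fun u hu => ?_⟩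
      calc V * u ≤ V * M := by gcongr
        _ = γ * (V * M / γ) := by field_simp
        _ ≤ _ := by gcongr; exact le_max_right _ _
    obtain ⟨K₁, h₁⟩ := hc.g₁_lipschitz
    obtain ⟨K₂, h₂⟩ := hc.g₂_lipschitz
    -- The side controlled by the bounded function is chosen first; the other function is then
    -- bounded on that compact side.
    rcases hc.bounded with ⟨M, hM⟩ | ⟨M, hM⟩
    · obtain ⟨b₂, hb₂, hb₂'⟩ := hstep (r := ξ.2) (M := M) hγ₂ hc.V₂_pos
      obtain ⟨M', hM'⟩ := (isCompact_Icc (a := (0 : ℝ)) (b := b₂)).bddAbove_image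
        (h₂.continuousOn.mono Icc_subset_Ici_self)
      obtain ⟨b₁, hb₁, hb₁'⟩ := hstep (r := ξ.1) (M := M') hγ₁ hc.V₁_pos
      exact ⟨b₁, b₂, hb₁, hb₂, fun s hs => hb₁' _ (hM' (mem_image_of_mem _ hs)),
        fun s hs => hb₂' _ (hM (mem_image_of_mem _ hs.1))⟩
    · obtain ⟨b₁, hb₁, hb₁'⟩ := hstep (r := ξ.1) (M := M) hγ₁ hc.V₁_pos
      obtain ⟨M', hM'⟩ := (isCompact_Icc (a := (0 : ℝ)) (b := b₁)).bddAbove_image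
        (h₁.continuousOn.mono Icc_subset_Ici_self)
      obtain ⟨b₂, hb₂, hb₂'⟩ := hstep (r := ξ.2) (M := M') hγ₂ hc.V₂_pos
      exact ⟨b₁, b₂, hb₁, hb₂, fun s hs => hb₁' _ (hM (mem_image_of_mem _ hs.1)),
        fun s hs => hb₂' _ (hM' (mem_image_of_mem _ hs))⟩
  obtain ⟨b₁, b₂, hb₁, hb₂, h₁, h₂⟩ := hbox
  obtain ⟨x, hx, -⟩ := hc.exists_isSolution_mem_boxN (N := 1) (a := 0) (fun _ _ => le_rfl)
    (hξ.1.trans hb₁) (hξ.2.trans hb₂) h₁ h₂ (ξ := fun _ => ξ)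
    (fun _ => ⟨⟨hξ.1, hb₁⟩, ⟨hξ.2, hb₂⟩⟩)
  refine ⟨fun t => x t 0, by simp [hx.init], fun t ht => hx.mem t ht 0, fun t ht => ?_⟩
  have := hasDerivWithinAt_pi.1 (hx.ode t ht) 0
  simpa [Compartment.networkField, Compartment.field] using this

theorem deriv_nonpos_of_le_left {y : ℝ → ℝ} {y' : ℝ} (hy : HasDerivWithinAt y y' (Ici 0) 0)
    (h : ∀ t, 0 ≤ t → y t ≤ y 0) : y' ≤ 0 := by
  have := (hasDerivWithinAt_iff_tendsto_slope' self_notMem_Ioi).1 hy.Ioi_of_Ici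
  refine le_of_tendsto this ?_
  filter_upwards [self_mem_nhdsWithin] with t ht
  rw [slope_def_field]
  exact div_nonpos_of_nonpos_of_nonneg (sub_nonpos.2 (h t (le_of_lt ht))) (by simpa using le_of_lt ht)

/-- A solution started on an upper face stays below it, so its normal velocity at time `0` is
nonpositive. Existence of that solution is essential: otherwise invariance could hold vacuously. -/
theorem Compartment.IsAdmissible.inward_of_forwardInvariant {c : Compartment}
    (hc : c.IsAdmissible) {b₁ b₂ : ℝ} (hb₁ : 0 ≤ b₁) (hb₂ : 0 ≤ b₂)
    (hB : ForwardInvariant c.field (Ici 0) (box b₁ b₂)) :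
    (∀ s ∈ Icc 0 b₂, c.V₁ * c.g₂ s ≤ c.γ₁ * b₁) ∧
      (∀ s ∈ Icc 0 b₁, c.V₂ * c.g₁ s ≤ c.γ₂ * b₂) := by
  constructor
  · intro s hs
    have hξ : (b₁, s) ∈ box b₁ b₂ := ⟨⟨hb₁, le_rfl⟩, hs⟩
    obtain ⟨x, hx⟩ := hc.exists_isSolution_field (ξ := (b₁, s)) ⟨hb₁, hs.1⟩
    have hd := (hx.ode 0 self_mem_Ici).hasFDerivWithinAt.fst.hasDerivWithinAt
    have := deriv_nonpos_of_le_left hd fun t ht => by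
      simpa [hx.init] using (hB _ hξ x hx t ht).1.2
    simp [hx.init, Compartment.field] at this
    linarith
  · intro s hs
    have hξ : (s, b₂) ∈ box b₁ b₂ := ⟨hs, ⟨hb₂, le_rfl⟩⟩
    obtain ⟨x, hx⟩ := hc.exists_isSolution_field (ξ := (s, b₂)) ⟨hs.1, hb₂⟩
    have hd := (hx.ode 0 self_mem_Ici).hasFDerivWithinAt.snd.hasDerivWithinAt
    have := deriv_nonpos_of_le_left hd fun t ht => by
      simpa [hx.init] using (hB _ hξ x hx t ht).2.2
    simp [hx.init, Compartment.field] at this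
    linarith

end Network

/-! ### Storage function for the second species -/

section Storage

open intervalIntegral

/-- With `Φ s = ∫ θ in 0..b, φ θ s`, splitting the integral at `u` bounds the increment by `u * (g
s' - g s)` from `[0, u]` plus `0` from `[u, b]`. -/
theorem exists_storage_of_kernel {g m : ℝ → ℝ} {φ : ℝ → ℝ → ℝ} {b : ℝ} {K : NNReal} (hb : 0 ≤ b)
    (hφc : ∀ s, 0 ≤ s → ContinuousOn (fun θ => φ θ s) (Icc 0 b))
    (hφl : ∀ θ ∈ Icc 0 b, LipschitzOnWith K (φ θ) (Ici 0))
    (hφ : ∀ u ∈ Icc 0 b, ∀ s s', 0 ≤ s → 0 ≤ s' → (s ≤ s' ∧ s' ≤ m u ∨ m u ≤ s' ∧ s' ≤ s) →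
      (∀ θ ∈ Icc 0 u, φ θ s' - φ θ s ≤ g s' - g s) ∧ (∀ θ ∈ Icc u b, φ θ s' - φ θ s ≤ 0)) :
    ∃ Φ : ℝ → ℝ, (∃ L, LipschitzOnWith L Φ (Ici 0)) ∧
      ∀ u ∈ Icc 0 b, ∀ s s', 0 ≤ s → 0 ≤ s' → (s ≤ s' ∧ s' ≤ m u ∨ m u ≤ s' ∧ s' ≤ s) →
        Φ s' - Φ s ≤ u * (g s' - g s) := by
  have hint : ∀ s s', 0 ≤ s → 0 ≤ s' → ∀ p q, 0 ≤ p → p ≤ q → q ≤ b →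
      IntervalIntegrable (fun θ => φ θ s' - φ θ s) MeasureTheory.volume p q := by
    intro s s' hs hs' p q hp hpq hq
    refine ContinuousOn.intervalIntegrable ?_
    rw [uIcc_of_le hpq]
    exact ((hφc s' hs').sub (hφc s hs)).mono (Icc_subset_Icc hp hq)
  have hint' : ∀ s, 0 ≤ s → IntervalIntegrable (fun θ => φ θ s) MeasureTheory.volume 0 b := by
    intro s hs
    refine ContinuousOn.intervalIntegrable ?_
    rw [uIcc_of_le hb]
    exact hφc s hs
  have hsub : ∀ s s', 0 ≤ s → 0 ≤ s' →
      (∫ θ in 0..b, φ θ s') - (∫ θ in 0..b, φ θ s) = ∫ θ in 0..b, (φ θ s' - φ θ s) :=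
    fun s s' hs hs' => (integral_sub (hint' s' hs') (hint' s hs)).symm
  refine ⟨fun s => ∫ θ in 0..b, φ θ s, ⟨K * b.toNNReal, ?_⟩, ?_⟩
  · refine LipschitzOnWith.of_dist_le_mul fun s' hs' s hs => ?_
    rw [Real.dist_eq, hsub s s' hs hs', NNReal.coe_mul, Real.coe_toNNReal _ hb]
    refine (norm_integral_le_of_norm_le_const (f := fun θ => φ θ s' - φ θ s)
      (C := K * dist s' s) fun θ hθ => ?_).trans
      (le_of_eq ?_)
    · rw [uIoc_of_le hb] at hθ
      exact (hφl θ (Ioc_subset_Icc_self hθ)).dist_le_mul _ hs' _ hs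
    · rw [sub_zero, abs_of_nonneg hb]; ring
  · intro u hu s s' hs hs' h
    obtain ⟨h₁, h₂⟩ := hφ u hu s s' hs hs' h
    simp only
    rw [hsub s s' hs hs', ← integral_add_adjacent_intervals
      (hint s s' hs hs' 0 u le_rfl hu.1 hu.2) (hint s s' hs hs' u b hu.1 hu.2 le_rfl)]
    have e₁ := integral_mono_on hu.1 (hint s s' hs hs' 0 u le_rfl hu.1 hu.2)
      (intervalIntegrable_const (c := g s' - g s)) h₁
    have e₂ := integral_mono_on hu.2 (hint s s' hs hs' u b hu.1 hu.2 le_rfl)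
      (intervalIntegrable_const (c := (0 : ℝ))) h₂
    simp at e₁ e₂
    linarith

/-- The kernel is `g` truncated at `m θ`: `g (max s (m θ))` in the increasing case, `g (min s (m
θ))` in the decreasing one. For `s` moving towards `m u`, monotonicity of `m` places `m θ` on a
known side of `m u`. Then the truncated increment either vanishes, or equals that of `g`, or has a
favourable sign or size by monotonicity of `g`. -/
theorem exists_storage {g m : ℝ → ℝ} {b : ℝ} {K : NNReal} (hb : 0 ≤ b)
    (hg : LipschitzOnWith K g (Ici 0)) (hmc : ContinuousOn m (Ici 0)) (hm : ∀ θ, 0 ≤ θ → 0 ≤ m θ)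
    (hmono : (MonotoneOn m (Ici 0) ∧ MonotoneOn g (Ici 0)) ∨
      (AntitoneOn m (Ici 0) ∧ AntitoneOn g (Ici 0))) :
    ∃ Φ : ℝ → ℝ, (∃ L, LipschitzOnWith L Φ (Ici 0)) ∧
      ∀ u ∈ Icc 0 b, ∀ s s', 0 ≤ s → 0 ≤ s' → (s ≤ s' ∧ s' ≤ m u ∨ m u ≤ s' ∧ s' ≤ s) →
        Φ s' - Φ s ≤ u * (g s' - g s) := by
  have hmc' : ContinuousOn m (Icc 0 b) := hmc.mono Icc_subset_Ici_self
  rcases hmono with ⟨h₁, h₂⟩ | ⟨h₁, h₂⟩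
  · refine exists_storage_of_kernel (φ := fun θ s => g (max s (m θ))) (K := K) hb ?_ ?_ ?_
    · exact fun s hs => hg.continuousOn.comp (continuousOn_const.sup hmc')
        fun θ _ => le_max_of_le_left hs
    · intro θ hθ
      refine LipschitzOnWith.of_dist_le_mul fun s hs s' hs' => ?_
      refine (hg.dist_le_mul _ (mem_Ici.2 (le_max_of_le_left hs)) _
        (mem_Ici.2 (le_max_of_le_left hs'))).trans ?_
      gcongr
      simpa [Real.dist_eq] using abs_max_sub_max_le_max s (m θ) s' (m θ)
    · intro u hu s s' hs hs' h
      refine ⟨fun θ hθ => ?_, fun θ hθ => ?_⟩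
      · have e := h₁ hθ.1 hu.1 hθ.2
        have m0 := hm θ hθ.1
        rcases le_total (m θ) s' with c | c <;> rcases le_total (m θ) s with c' | c'
        · simp [c, c']
        · rw [max_eq_left c, max_eq_right c']
          linarith [h₂ hs m0 c']
        -- Degenerate case: moving towards `m u ≥ m θ` cannot take `s` strictly below `m θ`, so `s'
        -- = m θ`.
        · have : s' ≤ s := c.trans c'
          have : m θ ≤ s' := by
            rcases h with h | h
            · linarith
            · linarith
          simp [this, c']
        · rw [max_eq_right c, max_eq_right c', sub_self]
          rcases h with h | h
          · linarith [h₂ hs hs' h.1]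
          · have : s' = m θ := by linarith
            have := h₂ hs m0 c'
            grind
      · have e := h₁ hu.1 (hu.1.trans hθ.1) hθ.1
        rcases h with h | h
        · rw [max_eq_right (h.2.trans e), max_eq_right (h.1.trans (h.2.trans e)), sub_self]
        · exact sub_nonpos.2 (h₂ (le_max_of_le_left hs') (le_max_of_le_left hs)
            (max_le_max_right _ h.2))
  · have hmin : ∀ {s θ}, 0 ≤ s → 0 ≤ θ → 0 ≤ min s (m θ) := fun hs hθ => le_min hs (hm _ hθ)
    refine exists_storage_of_kernel (φ := fun θ s => g (min s (m θ))) (K := K) hb ?_ ?_ ?_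
    · exact fun s hs => hg.continuousOn.comp (continuousOn_const.inf hmc')
        fun θ hθ => hmin hs hθ.1
    · intro θ hθ
      refine LipschitzOnWith.of_dist_le_mul fun s hs s' hs' => ?_
      refine (hg.dist_le_mul _ (hmin hs hθ.1) _ (hmin hs' hθ.1)).trans ?_
      gcongr
      simpa [Real.dist_eq] using abs_min_sub_min_le_max s (m θ) s' (m θ)
    · intro u hu s s' hs hs' h
      refine ⟨fun θ hθ => ?_, fun θ hθ => ?_⟩
      · have e := h₁ hθ.1 hu.1 hθ.2
        have m0 := hm θ hθ.1
        rcases h with h | h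
        · rw [min_eq_left (h.2.trans e), min_eq_left (h.1.trans (h.2.trans e))]
        · rcases le_total (m θ) s' with c | c
          · rw [min_eq_right c, min_eq_right (c.trans h.2)]
            linarith [h₂ hs' hs h.2]
          · rw [min_eq_left c]
            linarith [h₂ (hmin hs hθ.1) hs (min_le_left s (m θ))]
      · have e := h₁ hu.1 (hu.1.trans hθ.1) hθ.1
        have hθ0 := hu.1.trans hθ.1
        rcases h with h | h
        · exact sub_nonpos.2 (h₂ (hmin hs hθ0) (hmin hs' hθ0) (min_le_min_right _ h.1))
        · rw [min_eq_right (e.trans h.1), min_eq_right (e.trans (h.1.trans h.2)), sub_self]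

/-- The upper right derivative of `Φ(s) - u g(s)` along a trajectory is at most `-u' g(s)`. -/
theorem exists_slope_storage_le {g m Φ : ℝ → ℝ} {K L : NNReal} {b γ : ℝ} (hγ : 0 < γ)
    (hg : LipschitzOnWith K g (Ici 0)) (hΦl : LipschitzOnWith L Φ (Ici 0))
    (hΦ : ∀ u ∈ Icc 0 b, ∀ s s', 0 ≤ s → 0 ≤ s' → (s ≤ s' ∧ s' ≤ m u ∨ m u ≤ s' ∧ s' ≤ s) →
      Φ s' - Φ s ≤ u * (g s' - g s))
    {u s : ℝ → ℝ} {u' t : ℝ} (hu : HasDerivWithinAt u u' (Ici t) t)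
    (hs : HasDerivWithinAt s (γ * (m (u t) - s t)) (Ici t) t)
    (hub : u t ∈ Icc 0 b) (hs0 : ∀ z, t ≤ z → 0 ≤ s z) :
    ∃ ρ : ℝ → ℝ, Tendsto ρ (𝓝[>] t) (𝓝 (-(u' * g (s t)))) ∧
      ∀ᶠ z in 𝓝[>] t, slope (fun z => Φ (s z) - u z * g (s z)) t z ≤ ρ z := by
  have hst := hs0 t le_rfl
  have hsu := (hasDerivWithinAt_iff_tendsto_slope' self_notMem_Ioi).1 hu.Ioi_of_Ici
  have hss := (hasDerivWithinAt_iff_tendsto_slope' self_notMem_Ioi).1 hs.Ioi_of_Ici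
  have hsc : Tendsto s (𝓝[>] t) (𝓝 (s t)) := hs.Ioi_of_Ici.continuousWithinAt
  have hgc : Tendsto (fun z => g (s z)) (𝓝[>] t) (𝓝 (g (s t))) := by
    refine (hg.continuousOn (s t) hst).tendsto.comp
      (tendsto_nhdsWithin_iff.2 ⟨hsc, ?_⟩)
    filter_upwards [self_mem_nhdsWithin] with z hz using hs0 z (le_of_lt hz)
  -- If `s t ≠ m (u t)`, then `s` moves strictly towards `m (u t)` and does not reach it for a short
  -- time, so `hΦ` applies. If they are equal, `s` has zero velocity and the Lipschitz bounds leave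
  -- an `o(z - t)` error.
  have hrem : ∃ τ : ℝ → ℝ, Tendsto τ (𝓝[>] t) (𝓝 0) ∧
      ∀ᶠ z in 𝓝[>] t, Φ (s z) - Φ (s t) - u t * (g (s z) - g (s t)) ≤ τ z * (z - t) := by
    rcases lt_trichotomy (m (u t)) (s t) with h | h | h
    · refine ⟨fun _ => 0, tendsto_const_nhds, ?_⟩
      have hneg : γ * (m (u t) - s t) < 0 := mul_neg_of_pos_of_neg hγ (sub_neg.2 h)
      filter_upwards [hsc.eventually (lt_mem_nhds h), hss.eventually (gt_mem_nhds hneg),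
        self_mem_nhdsWithin] with z h₁ h₂ h₃
      have hz : t < z := h₃
      rw [slope_def_field, div_lt_iff₀ (sub_pos.2 hz), zero_mul, sub_neg] at h₂
      have := hΦ (u t) hub (s t) (s z) hst (hs0 z hz.le) (Or.inr ⟨h₁.le, h₂.le⟩)
      linarith
    · have hzero : γ * (m (u t) - s t) = 0 := by rw [h]; ring
      rw [hzero] at hss
      refine ⟨fun z => (L + |u t| * K) * |slope s t z|, ?_, ?_⟩
      · simpa using hss.abs.const_mul ((L : ℝ) + |u t| * K)
      · filter_upwards [self_mem_nhdsWithin] with z hz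
        have hz' : t < z := hz
        have e₁ := (le_abs_self _).trans (hΦl.dist_le_mul _ (hs0 z hz'.le) _ hst)
        have e₂ := hg.dist_le_mul _ (hs0 z hz'.le) _ hst
        simp only [Real.dist_eq] at e₁ e₂
        have e₃ : |slope s t z| * (z - t) = |s z - s t| := by
          rw [slope_def_field, abs_div, abs_of_pos (sub_pos.2 hz'),
            div_mul_cancel₀ _ (sub_pos.2 hz').ne']
        have e₄ := neg_abs_le (u t * (g (s z) - g (s t)))
        rw [abs_mul] at e₄
        have e₅ := mul_le_mul_of_nonneg_left e₂ (abs_nonneg (u t))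
        rw [mul_assoc, e₃]
        linarith
    · refine ⟨fun _ => 0, tendsto_const_nhds, ?_⟩
      have hpos : 0 < γ * (m (u t) - s t) := mul_pos hγ (sub_pos.2 h)
      filter_upwards [hsc.eventually (gt_mem_nhds h), hss.eventually (lt_mem_nhds hpos),
        self_mem_nhdsWithin] with z h₁ h₂ h₃
      have hz : t < z := h₃
      rw [slope_def_field, lt_div_iff₀ (sub_pos.2 hz), zero_mul, sub_pos] at h₂
      have := hΦ (u t) hub (s t) (s z) hst (hs0 z hz.le) (Or.inl ⟨h₂.le, h₁.le⟩)
      linarith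
  obtain ⟨τ, hτ, hτ'⟩ := hrem
  refine ⟨fun z => τ z - slope u t z * g (s z), ?_, ?_⟩
  · simpa using hτ.sub (hsu.mul hgc)
  · filter_upwards [hτ', self_mem_nhdsWithin] with z h₁ hz
    have hz' : 0 < z - t := sub_pos.2 hz
    rw [slope_def_field, slope_def_field, div_le_iff₀ hz', sub_mul, mul_right_comm,
      div_mul_cancel₀ _ hz'.ne']
    linarith

end Storage

/-! ### Vanishing dissipation and tracking of slowly varying inputs -/

section Barbalat

/-- If `D t ≥ ε`, uniform continuity keeps `D ≥ ε / 2` for a time `δ / 2`, so `E` drops by `ε / 2 *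
(δ / 2)`. This is impossible once `E` is closer than that to its infimum. -/
theorem tendsto_zero_of_dissipation {E D : ℝ → ℝ} {B : ℝ} (hE : ContinuousOn E (Ici 0))
    (hB : ∀ t, 0 ≤ t → B ≤ E t) (hD0 : ∀ t, 0 ≤ t → 0 ≤ D t) (hD : UniformContinuousOn D (Ici 0))
    (h : ∀ t, 0 ≤ t → ∀ r, -D t < r → ∃ᶠ z in 𝓝[>] t, slope E t z < r) :
    Tendsto D atTop (𝓝 0) := by
  have key : ∀ t t' d : ℝ, 0 ≤ t → t ≤ t' → (∀ z ∈ Icc t t', d ≤ D z) →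
      E t' ≤ E t - d * (t' - t) := by
    intro t t' d ht htt' hd
    refine image_le_of_liminf_slope_right_le_deriv_boundary (f := E) (a := t) (b := t')
      (B := fun z => E t - d * (z - t)) (B' := fun _ => -d)
      (hE.mono fun z hz => ht.trans hz.1) (by simp) (by fun_prop) (fun z _ => ?_)
      (fun z hz r hr => h z (ht.trans hz.1) r
        ((neg_le_neg (hd z (Ico_subset_Icc_self hz))).trans_lt hr)) (right_mem_Icc.2 htt')
    simpa using ((((hasDerivAt_id z).sub_const t).const_mul d).const_sub (E t)).hasDerivWithinAt
  rw [Metric.tendsto_atTop]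
  intro ε hε
  obtain ⟨δ, hδ, hδ'⟩ := Metric.uniformContinuousOn_iff.1 hD (ε / 2) (half_pos hε)
  have hbdd : BddBelow (E '' Ici 0) := ⟨B, by rintro _ ⟨t, ht, rfl⟩; exact hB t ht⟩
  obtain ⟨_, ⟨T, hT, rfl⟩, hT'⟩ := exists_lt_of_csInf_lt (nonempty_Ici.image E)
    (lt_add_of_pos_right (sInf (E '' Ici 0)) (show 0 < ε / 2 * (δ / 2) by positivity))
  refine ⟨T, fun t htT => ?_⟩
  have ht : 0 ≤ t := le_trans hT htT
  rw [Real.dist_eq, sub_zero, abs_of_nonneg (hD0 t ht)]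
  by_contra! hcon
  have h₁ : E t ≤ E T := by
    simpa using key T t 0 hT htT fun z hz => hD0 z (le_trans hT hz.1)
  have h₂ := key t (t + δ / 2) (ε / 2) ht (by linarith) fun z hz => by
    have := hδ' z (ht.trans hz.1) t ht (by
      rw [Real.dist_eq, abs_of_nonneg (sub_nonneg.2 hz.1)]; linarith [hz.2])
    rw [Real.dist_eq, abs_lt] at this
    linarith
  have h₃ : sInf (E '' Ici 0) ≤ E (t + δ / 2) :=
    csInf_le hbdd (mem_image_of_mem _ (by simp only [mem_Ici]; linarith))
  rw [add_sub_cancel_left] at h₂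
  linarith

/-- On the window `[t - T, t]` the input is nearly `w t`. Grönwall with rate `-γ` leaves the initial
gap, at most `C * exp (-γ * T)`, plus the oscillation of `w`; each is at most `ε / 2`. -/
theorem eventually_le_of_slowly_varying {s w : ℝ → ℝ} {γ C : ℝ} (hγ : 0 < γ)
    (hs : ∀ t, 0 ≤ t → HasDerivWithinAt s (γ * (w t - s t)) (Ici 0) t)
    (hC : ∀ t τ, 0 ≤ t → 0 ≤ τ → s t - w τ ≤ C)
    (hw : ∀ T, 0 ≤ T → ∀ ε, 0 < ε → ∀ᶠ t in atTop, ∀ τ ∈ Icc (t - T) t, w τ - w t ≤ ε)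
    {ε : ℝ} (hε : 0 < ε) : ∀ᶠ t in atTop, s t - w t ≤ ε := by
  have hlim : Tendsto (fun T : ℝ => C * Real.exp (-γ * T)) atTop (𝓝 0) := by
    have h : Tendsto (fun T : ℝ => -γ * T) atTop atBot :=
      tendsto_id.const_mul_atTop_of_neg (neg_neg_of_pos hγ)
    simpa using (Real.tendsto_exp_atBot.comp h).const_mul C
  obtain ⟨T, hT, hT0⟩ :=
    ((hlim.eventually (gt_mem_nhds (half_pos hε))).and (eventually_ge_atTop 0)).exists
  filter_upwards [hw T hT0 (ε / 2) (half_pos hε), eventually_ge_atTop T] with t ht htT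
  have h0 : 0 ≤ t - T := sub_nonneg.2 htT
  have hmono : t - T ≤ t := by linarith
  have hc : ContinuousOn s (Icc (t - T) t) := fun z hz =>
    (hs z (h0.trans hz.1)).continuousWithinAt.mono fun y hy => h0.trans hy.1
  have := le_gronwallBound_of_liminf_deriv_right_le (f := fun z => s z - w t)
    (f' := fun z => γ * (w z - s z)) (δ := C) (K := -γ) (ε := γ * (ε / 2)) (a := t - T) (b := t)
    (hc.sub continuousOn_const)
    (fun z hz r hr => by
      have hz0 := h0.trans hz.1
      have := (((hs z hz0).sub_const (w t)).mono
        (Ici_subset_Ici.2 hz0)).liminf_right_slope_le hr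
      simpa [slope_def_field, div_eq_inv_mul] using this)
    (hC _ _ h0 (h0.trans hmono))
    (fun z hz => by nlinarith [ht z (Ico_subset_Icc_self hz)])
    t (right_mem_Icc.2 hmono)
  rw [gronwallBound_of_K_ne_0 (neg_ne_zero.2 hγ.ne')] at this
  simp only [sub_sub_cancel] at this
  have e : γ * (ε / 2) / -γ = -(ε / 2) := by field_simp
  rw [e] at this
  nlinarith [Real.exp_pos (-γ * T)]

theorem tendsto_sub_zero_of_slowly_varying {s w : ℝ → ℝ} {γ C : ℝ} (hγ : 0 < γ)
    (hs : ∀ t, 0 ≤ t → HasDerivWithinAt s (γ * (w t - s t)) (Ici 0) t)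
    (hC : ∀ t τ, 0 ≤ t → 0 ≤ τ → |s t - w τ| ≤ C)
    (hw : ∀ T, 0 ≤ T → ∀ ε, 0 < ε → ∀ᶠ t in atTop, ∀ τ ∈ Icc (t - T) t, |w τ - w t| ≤ ε) :
    Tendsto (fun t => s t - w t) atTop (𝓝 0) := by
  rw [(nhds_basis_abs_sub_lt (0 : ℝ)).tendsto_right_iff]
  intro ε hε
  have h₁ := eventually_le_of_slowly_varying hγ hs (fun t τ ht hτ => (abs_le.1 (hC t τ ht hτ)).2)
    (fun T hT η hη => (hw T hT η hη).mono fun t h τ hτ => (abs_le.1 (h τ hτ)).2) (half_pos hε)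
  have h₂ := eventually_le_of_slowly_varying (s := fun t => -s t) (w := fun t => -w t) hγ
    (fun t ht => by
      have := (hs t ht).neg
      rwa [show -(γ * (w t - s t)) = γ * (-w t - -s t) by ring] at this)
    (fun t τ ht hτ => by have := (abs_le.1 (hC t τ ht hτ)).1; show -s t - -w τ ≤ C; linarith)
    (fun T hT η hη => (hw T hT η hη).mono fun t h τ hτ => by
      have := (abs_le.1 (h τ hτ)).1; show -w τ - -w t ≤ η; linarith) (half_pos hε)
  filter_upwards [h₁, h₂] with t e₁ e₂
  rw [sub_zero, abs_lt]
  constructor <;> linarith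

end Barbalat

/-! ### Limit sets of curves in compact sets -/

section LimitSet

variable {X : Type*} [MetricSpace X]

theorem mem_of_mem_omegaLimitSet {K : Set X} (hK : IsClosed K) {x : ℝ → X}
    (hx : ∀ t, 0 ≤ t → x t ∈ K) {p : X} (hp : p ∈ omegaLimitSet x) : p ∈ K := by
  have hp' : MapClusterPt p atTop x := hp
  refine hK.mem_of_frequently_of_tendsto ?_ tendsto_id
  rw [mapClusterPt_iff_frequently] at hp'
  rw [frequently_iff]
  intro U hU
  obtain ⟨t, htU, ht0⟩ := ((hp' U hU).and_eventually (eventually_ge_atTop 0)).exists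
  exact ⟨x t, htU, hx t ht0⟩

/-- A curve that returns near `p` and also leaves infinitely often crosses a small sphere around `p`
at arbitrarily late times. By compactness it has a limit point on that sphere, which contradicts the
isolation of `p` in `S`. -/
theorem tendsto_of_isDiscrete_omegaLimitSet {K S : Set X} (hK : IsCompact K) (hS : IsDiscrete S)
    {x : ℝ → X} (hxc : ContinuousOn x (Ici 0)) (hx : ∀ t, 0 ≤ t → x t ∈ K)
    (hω : omegaLimitSet x ⊆ S) : ∃ p ∈ S, Tendsto x atTop (𝓝 p) := by
  have hxK : ∀ᶠ t in atTop, x t ∈ K := (eventually_ge_atTop 0).mono hx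
  obtain ⟨p, -, hp⟩ := hK.exists_mapClusterPt (u := x) (le_principal_iff.2 hxK)
  have hpS : p ∈ S := hω hp
  refine ⟨p, hpS, ?_⟩
  obtain ⟨U, hU, hUS⟩ := nhds_inter_eq_singleton_of_mem_discrete hS hpS
  obtain ⟨r, hr, hrU⟩ := Metric.mem_nhds_iff.1 hU
  rw [Metric.tendsto_nhds]
  by_contra! hcon
  obtain ⟨ε, hε, hfar⟩ := hcon
  set η := min ε (r / 2) with hη
  have hη0 : 0 < η := lt_min hε (half_pos hr)
  have hnear := mapClusterPt_iff_frequently.1 hp (Metric.ball p η) (Metric.ball_mem_nhds p hη0)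
  have hsphere : ∃ᶠ t in atTop, x t ∈ K ∩ Metric.sphere p η := by
    rw [frequently_atTop]
    intro T
    obtain ⟨t₁, ht₁, h₁⟩ := (frequently_atTop.1 hnear) (max T 0)
    obtain ⟨t₂, ht₂, h₂⟩ := (frequently_atTop.1 hfar) t₁
    have ht₁0 : 0 ≤ t₁ := (le_max_right _ _).trans ht₁
    have hcont : ContinuousOn (fun t => dist (x t) p) (Icc t₁ t₂) :=
      (continuous_id.dist continuous_const).comp_continuousOn
        (hxc.mono fun t ht => ht₁0.trans ht.1)
    obtain ⟨t, ht, hteq⟩ := intermediate_value_Icc ht₂ hcont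
      ⟨(Metric.mem_ball.1 h₁).le, (min_le_left _ _).trans h₂⟩
    exact ⟨t, ((le_max_left _ _).trans ht₁).trans ht.1, hx t (ht₁0.trans ht.1), hteq⟩
  obtain ⟨q, hq, hqc⟩ := (hK.inter_right Metric.isClosed_sphere).exists_mapClusterPt_of_frequently
    hsphere
  have hqU : q ∈ U ∩ S := by
    refine ⟨hrU ?_, hω hqc⟩
    rw [Metric.mem_ball, Metric.mem_sphere.1 hq.2]
    exact (min_le_right _ _).trans_lt (half_lt_self hr)
  rw [hUS, mem_singleton_iff] at hqU
  have := Metric.mem_sphere.1 hq.2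
  rw [hqU, dist_self] at this
  exact hη0.ne this

end LimitSet

/-! ### Energy decay and convergence to equilibria -/

section Energy

variable {N : ℕ}

/-- Discrete Green formula: exchanging `i` and `j` identifies the two halves of the sum. It makes
the coupling the negative gradient of the quadratic form in `energy`. -/
theorem sum_laplacian_by_parts {a : Fin N → Fin N → ℝ} (ha : ∀ i j, a i j = a j i)
    (u v : Fin N → ℝ) :
    (∑ i, ∑ j, a i j * ((u i - u j) * (v i - v j))) =
      -2 * ∑ i, v i * ∑ j, a i j * (u j - u i) := by
  have h₁ : (∑ i, ∑ j, a i j * ((u i - u j) * (v i - v j))) =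
      (∑ i, ∑ j, a i j * ((u i - u j) * v i)) - ∑ i, ∑ j, a i j * ((u i - u j) * v j) := by
    simp only [← Finset.sum_sub_distrib]
    exact Finset.sum_congr rfl fun i _ => Finset.sum_congr rfl fun j _ => by ring
  have h₂ : (∑ i, ∑ j, a i j * ((u i - u j) * v j)) =
      -∑ i, ∑ j, a i j * ((u i - u j) * v i) := by
    rw [Finset.sum_comm]
    simp only [← Finset.sum_neg_distrib]
    exact Finset.sum_congr rfl fun i _ => Finset.sum_congr rfl fun j _ => by rw [ha j i]; ring
  have h₃ : (∑ i, ∑ j, a i j * ((u i - u j) * v i)) = -∑ i, v i * ∑ j, a i j * (u j - u i) := by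
    simp only [Finset.mul_sum, ← Finset.sum_neg_distrib]
    exact Finset.sum_congr rfl fun i _ => Finset.sum_congr rfl fun j _ => by ring
  rw [h₁, h₂, h₃]
  ring

/-- The energy of the network, where `Φ` is a storage function of the second species. -/
noncomputable def energy (c : Compartment) (a : Fin N → Fin N → ℝ) (Φ : ℝ → ℝ)
    (x : Fin N → ℝ × ℝ) : ℝ :=
  ((∑ i, c.γ₁ / 2 * (x i).1 ^ 2) + 1 / 4 * ∑ i, ∑ j, a i j * ((x i).1 - (x j).1) ^ 2) +
    c.V₁ * ∑ i, (Φ (x i).2 - (x i).1 * c.g₂ (x i).2)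

theorem continuousOn_energy {c : Compartment} (a : Fin N → Fin N → ℝ) {Φ : ℝ → ℝ}
    (hΦ : ContinuousOn Φ (Ici 0)) (hg : ContinuousOn c.g₂ (Ici 0)) :
    ContinuousOn (energy c a Φ) (Ici 0) := by
  have h₁ : ∀ i, ContinuousOn (fun x : Fin N → ℝ × ℝ => Φ (x i).2) (Ici 0) := fun i =>
    hΦ.comp (by fun_prop) fun x hx => (hx i).2
  have h₂ : ∀ i, ContinuousOn (fun x : Fin N → ℝ × ℝ => c.g₂ (x i).2) (Ici 0) := fun i =>
    hg.comp (by fun_prop) fun x hx => (hx i).2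
  refine ContinuousOn.add (Continuous.continuousOn (by fun_prop)) ?_
  exact continuousOn_const.mul (continuousOn_finsetSum _ fun i _ =>
    (h₁ i).sub (ContinuousOn.mul (Continuous.continuousOn (by fun_prop)) (h₂ i)))

theorem slope_finset_sum {ι : Type*} (s : Finset ι) (f : ι → ℝ → ℝ) (t z : ℝ) :
    slope (fun z => ∑ i ∈ s, f i z) t z = ∑ i ∈ s, slope (f i) t z := by
  simp only [slope_def_field, ← Finset.sum_sub_distrib, Finset.sum_div]

/-- Along solutions in the box, the upper right derivative of the energy is at most the negative
of the squared speed of the first species. -/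
theorem frequently_slope_energy_lt {c : Compartment} (hc : c.IsAdmissible)
    {a : Fin N → Fin N → ℝ} (ha : ∀ i j, a i j = a j i) {b₁ b₂ : ℝ} {Φ : ℝ → ℝ} {L : NNReal}
    (hΦl : LipschitzOnWith L Φ (Ici 0))
    (hΦ : ∀ u ∈ Icc 0 b₁, ∀ s s', 0 ≤ s → 0 ≤ s' →
      (s ≤ s' ∧ s' ≤ c.V₂ / c.γ₂ * c.g₁ u ∨ c.V₂ / c.γ₂ * c.g₁ u ≤ s' ∧ s' ≤ s) →
        Φ s' - Φ s ≤ u * (c.g₂ s' - c.g₂ s))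
    {x : ℝ → Fin N → ℝ × ℝ} (hx : IsIntegralCurveOn x (fun _ => c.networkField a) (Ici 0))
    (hmem : ∀ t, 0 ≤ t → x t ∈ boxN N b₁ b₂) {t : ℝ} (ht : 0 ≤ t) {r : ℝ}
    (hr : -∑ i, (c.networkField a (x t) i).1 ^ 2 < r) :
    ∃ᶠ z in 𝓝[>] t, slope (fun z => energy c a Φ (x z)) t z < r := by
  obtain ⟨K₂, hg₂⟩ := hc.g₂_lipschitz
  have hd := fun i => hasDerivWithinAt_coord ((hx t ht).mono (Ici_subset_Ici.2 ht)) i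
  have hs : ∀ i, HasDerivWithinAt (fun z => (x z i).2)
      (c.γ₂ * (c.V₂ / c.γ₂ * c.g₁ (x t i).1 - (x t i).2)) (Ici t) t := by
    intro i
    have hγ := hc.γ₂_pos.ne'
    convert (hd i).2 using 1
    simp only [Compartment.networkField]
    field_simp
    ring
  have hρ := fun i => exists_slope_storage_le (m := fun u => c.V₂ / c.γ₂ * c.g₁ u) hc.γ₂_pos hg₂
    hΦl hΦ (hd i).1 (hs i) (hmem t ht i).1 fun z hz => (hmem z (ht.trans hz) i).2.1
  choose ρ hρ hρ' using hρ
  let Q : ℝ → ℝ := fun z => (∑ i, c.γ₁ / 2 * (x z i).1 ^ 2) +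
    1 / 4 * ∑ i, ∑ j, a i j * ((x z i).1 - (x z j).1) ^ 2
  have hQ : HasDerivWithinAt Q
      (∑ i, (c.networkField a (x t) i).1 *
        (c.V₁ * c.g₂ (x t i).2 - (c.networkField a (x t) i).1)) (Ici t) t := by
    have h₁ := HasDerivWithinAt.fun_sum (u := Finset.univ) fun i _ =>
      ((hd i).1.pow 2).const_mul (c.γ₁ / 2)
    have h₂ := HasDerivWithinAt.fun_sum (u := Finset.univ) fun i _ =>
      HasDerivWithinAt.fun_sum (u := Finset.univ) fun j _ =>
        ((((hd i).1.sub (hd j).1).pow 2).const_mul (a i j))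
    refine (h₁.add (h₂.const_mul (1 / 4))).congr_deriv ?_
    have h₃ := sum_laplacian_by_parts ha (fun i => (x t i).1)
      (fun i => (c.networkField a (x t) i).1)
    have h₄ : (∑ i, ∑ j, a i j * ((2 : ℕ) * ((x t i).1 - (x t j).1) ^ (2 - 1) *
        ((c.networkField a (x t) i).1 - (c.networkField a (x t) j).1))) =
        2 * ∑ i, ∑ j, a i j * (((x t i).1 - (x t j).1) *
          ((c.networkField a (x t) i).1 - (c.networkField a (x t) j).1)) := by
      simp only [Finset.mul_sum]
      exact Finset.sum_congr rfl fun i _ => Finset.sum_congr rfl fun j _ => by push_cast; ring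
    simp only [Pi.sub_apply] at h₄ ⊢
    rw [h₄, h₃]
    -- The weight `1 / 4` cancels the `2` from the square and the `2` from counting each pair twice.
    have h₅ : ∀ y : ℝ, 1 / 4 * (2 * (-2 * y)) = -y := fun y => by ring
    rw [h₅, ← sub_eq_add_neg, ← Finset.sum_sub_distrib]
    refine Finset.sum_congr rfl fun i _ => ?_
    simp only [Compartment.networkField]
    push_cast
    ring
  have hQs := (hasDerivWithinAt_iff_tendsto_slope' self_notMem_Ioi).1 hQ.Ioi_of_Ici
  have hlim : Tendsto (fun z => slope Q t z + c.V₁ * ∑ i, ρ i z) (𝓝[>] t)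
      (𝓝 (-∑ i, (c.networkField a (x t) i).1 ^ 2)) := by
    have := hQs.add ((tendsto_finsetSum Finset.univ fun i _ => hρ i).const_mul c.V₁)
    convert this using 2
    rw [Finset.mul_sum, ← Finset.sum_add_distrib, ← Finset.sum_neg_distrib]
    exact Finset.sum_congr rfl fun i _ => by ring
  refine Eventually.frequently ?_
  filter_upwards [hlim.eventually (gt_mem_nhds hr), eventually_all.2 hρ'] with z h₁ h₂
  refine lt_of_le_of_lt ?_ h₁
  have hslope : slope (fun z => energy c a Φ (x z)) t z = slope Q t z +
      c.V₁ * ∑ i, slope (fun z => Φ (x z i).2 - (x z i).1 * c.g₂ (x z i).2) t z := by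
    rw [← slope_finset_sum]
    simp only [slope_def_field, energy, Q]
    ring
  rw [hslope]
  have := hc.V₁_pos
  gcongr with i
  exact h₂ i

/-- The velocity of every solution in the box tends to zero. -/
theorem Compartment.IsAdmissible.tendsto_networkField_zero {c : Compartment} (hc : c.IsAdmissible)
    {a : Fin N → Fin N → ℝ} (ha : ∀ i j, a i j = a j i) {b₁ b₂ : ℝ} (hb₁ : 0 ≤ b₁)
    {x : ℝ → Fin N → ℝ × ℝ} (hx : IsIntegralCurveOn x (fun _ => c.networkField a) (Ici 0))
    (hmem : ∀ t, 0 ≤ t → x t ∈ boxN N b₁ b₂) :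
    Tendsto (fun t => c.networkField a (x t)) atTop (𝓝 0) := by
  obtain ⟨K, hF⟩ := hc.exists_lipschitzOnWith_networkField a
  obtain ⟨K₁, hg₁⟩ := hc.g₁_lipschitz
  obtain ⟨K₂, hg₂⟩ := hc.g₂_lipschitz
  have hV₂ := hc.V₂_pos
  have hγ₂ := hc.γ₂_pos
  have hk : 0 < c.V₂ / c.γ₂ := by positivity
  have hFc : ContinuousOn (c.networkField a) (boxN N b₁ b₂) :=
    hF.continuousOn.mono boxN_subset_Ici
  have hcpt := isCompact_boxN (N := N) b₁ b₂
  have hk_mono : Monotone fun y => c.V₂ / c.γ₂ * y := fun y y' h => by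
    simp only; gcongr
  obtain ⟨Φ, ⟨L, hΦl⟩, hΦ⟩ := exists_storage (g := c.g₂) (m := fun u => c.V₂ / c.γ₂ * c.g₁ u)
    hb₁ hg₂ (hg₁.continuousOn.const_mul _) (fun θ hθ => mul_nonneg hk.le (hc.g₁_nonneg θ hθ))
    (hc.monotone.imp (fun h => ⟨hk_mono.comp_monotoneOn h.1, h.2⟩)
      fun h => ⟨hk_mono.comp_antitoneOn h.1, h.2⟩)
  -- Bounded speed makes the dissipation uniformly continuous in time, as the Barbalat argument
  -- needs.
  have hxlip : ∃ C, LipschitzOnWith C x (Ici 0) := by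
    obtain ⟨C, hC⟩ := (hcpt.image_of_continuousOn hFc).isBounded.exists_norm_le
    refine ⟨C.toNNReal, (convex_Ici (0 : ℝ)).lipschitzOnWith_of_nnnorm_hasDerivWithin_le
      (fun t ht => hx t ht) fun t ht => ?_⟩
    exact NNReal.coe_le_coe.1 ((hC _ (mem_image_of_mem _ (hmem t ht))).trans
      (Real.le_coe_toNNReal C))
  obtain ⟨C, hC⟩ := hxlip
  have hE := continuousOn_energy a hΦl.continuousOn hg₂.continuousOn
  have hspeed : Tendsto (fun t => ∑ i, (c.networkField a (x t) i).1 ^ 2) atTop (𝓝 0) := by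
    obtain ⟨B, hB⟩ := hcpt.bddBelow_image (hE.mono boxN_subset_Ici)
    refine tendsto_zero_of_dissipation (E := fun t => energy c a Φ (x t)) (B := B)
      (hE.comp hx.continuousOn fun t ht => boxN_subset_Ici (hmem t ht))
      (fun t ht => hB (mem_image_of_mem _ (hmem t ht)))
      (fun t _ => Finset.sum_nonneg fun i _ => sq_nonneg _) ?_
      (fun t ht r hr => frequently_slope_energy_lt hc ha hΦl hΦ hx hmem ht hr)
    have hD : ContinuousOn (fun y => ∑ i, (c.networkField a y i).1 ^ 2) (boxN N b₁ b₂) := by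
      have : ∀ i, ContinuousOn (fun y => (c.networkField a y i).1) (boxN N b₁ b₂) := fun i =>
        continuous_fst.comp_continuousOn ((continuous_apply i).comp_continuousOn hFc)
      fun_prop
    exact (hcpt.uniformContinuousOn_of_continuous hD).comp hC.uniformContinuousOn
      fun t ht => hmem t ht
  have hfst : ∀ i, Tendsto (fun t => (c.networkField a (x t) i).1) atTop (𝓝 0) := by
    intro i
    have hsq : Tendsto (fun t => (c.networkField a (x t) i).1 ^ 2) atTop (𝓝 0) :=
      squeeze_zero (fun t => sq_nonneg _) (fun t => Finset.single_le_sum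
        (f := fun i => (c.networkField a (x t) i).1 ^ 2) (fun j _ => sq_nonneg _)
        (Finset.mem_univ i)) hspeed
    have := hsq.sqrt
    simp only [Real.sqrt_sq_eq_abs, Real.sqrt_zero] at this
    exact (tendsto_zero_iff_abs_tendsto_zero _).2 this
  have hsnd : ∀ i, Tendsto (fun t => (c.networkField a (x t) i).2) atTop (𝓝 0) := by
    intro i
    have hmlip : ∀ {u v}, u ∈ Ici (0 : ℝ) → v ∈ Ici (0 : ℝ) →
        |c.V₂ / c.γ₂ * c.g₁ u - c.V₂ / c.γ₂ * c.g₁ v| ≤ c.V₂ / c.γ₂ * (K₁ * |u - v|) := by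
      intro u v hu hv
      rw [← mul_sub, abs_mul, abs_of_pos hk]
      exact mul_le_mul_of_nonneg_left (hg₁.dist_le_mul _ hu _ hv) hk.le
    have hd := fun t ht => (hasDerivWithinAt_coord (hx t ht) i).1
    have hd₂ : ∀ t, 0 ≤ t → HasDerivWithinAt (fun t => (x t i).2)
        (c.γ₂ * (c.V₂ / c.γ₂ * c.g₁ (x t i).1 - (x t i).2)) (Ici 0) t := by
      intro t ht
      convert (hasDerivWithinAt_coord (hx t ht) i).2 using 1
      simp only [Compartment.networkField]
      field_simp
      ring
    obtain ⟨M, hM⟩ := (isCompact_Icc (a := (0 : ℝ)) (b := b₁)).bddAbove_image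
      (hg₁.continuousOn.mono Icc_subset_Ici_self)
    have hbound : ∀ t τ, 0 ≤ t → 0 ≤ τ →
        |(x t i).2 - c.V₂ / c.γ₂ * c.g₁ (x τ i).1| ≤ b₂ + c.V₂ / c.γ₂ * M := by
      intro t τ ht hτ
      have h₁ := (hmem t ht i).2
      have h₂ := (hmem τ hτ i).1
      have h₃ := mul_le_mul_of_nonneg_left (hM (mem_image_of_mem _ h₂)) hk.le
      have h₄ := mul_nonneg hk.le (hc.g₁_nonneg _ h₂.1)
      rw [abs_le]
      constructor <;> linarith [h₁.1, h₁.2]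
    have hslow : ∀ T, 0 ≤ T → ∀ ε, 0 < ε → ∀ᶠ t in atTop, ∀ τ ∈ Icc (t - T) t,
        |c.V₂ / c.γ₂ * c.g₁ (x τ i).1 - c.V₂ / c.γ₂ * c.g₁ (x t i).1| ≤ ε := by
      intro T hT ε hε
      -- A speed below `η` over a time `T` changes `V₂ / γ₂ * g₁` by at most `ε`; the added ones
      -- keep the denominator positive.
      let η : ℝ := ε / (c.V₂ / c.γ₂ * (K₁ + 1) * (T + 1))
      have hη : 0 < η := by positivity
      obtain ⟨T₀, hT₀⟩ := eventually_atTop.1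
        ((tendsto_zero_iff_abs_tendsto_zero _).1 (hfst i) |>.eventually (gt_mem_nhds hη))
      filter_upwards [eventually_ge_atTop (max T₀ 0 + T)] with t ht τ hτ
      have hτ₀ : max T₀ 0 ≤ τ := by linarith [hτ.1]
      have hτ0 : 0 ≤ τ := (le_max_right _ _).trans hτ₀
      have h₁ : |(x τ i).1 - (x t i).1| ≤ η * T := by
        have := (convex_Icc τ t).norm_image_sub_le_of_norm_hasDerivWithin_le
          (f := fun t => (x t i).1) (C := η)
          (fun z hz => (hd z (hτ0.trans hz.1)).mono fun y hy => hτ0.trans hy.1)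
          (fun z hz => (hT₀ z (((le_max_left _ _).trans hτ₀).trans hz.1)).le)
          (right_mem_Icc.2 hτ.2) (left_mem_Icc.2 hτ.2)
        refine this.trans (mul_le_mul_of_nonneg_left ?_ hη.le)
        rw [Real.norm_eq_abs, abs_sub_comm, abs_of_nonneg (sub_nonneg.2 hτ.2)]
        linarith [hτ.1]
      refine (hmlip (hmem τ hτ0 i).1.1 (hmem t (hτ0.trans hτ.2) i).1.1).trans ?_
      calc c.V₂ / c.γ₂ * (K₁ * |(x τ i).1 - (x t i).1|)
          ≤ c.V₂ / c.γ₂ * ((K₁ + 1) * (η * (T + 1))) := by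
            gcongr
            · linarith
            · exact h₁.trans (by gcongr; linarith)
        _ = ε := by simp only [η]; field_simp
    have := (tendsto_sub_zero_of_slowly_varying hγ₂ hd₂ hbound hslow).const_mul (-c.γ₂)
    rw [mul_zero] at this
    refine this.congr fun t => ?_
    simp only [Compartment.networkField]
    field_simp
    ring
  exact tendsto_pi_nhds.2 fun i => (hfst i).prodMk_nhds (hsnd i)

theorem Compartment.IsAdmissible.omegaLimitSet_subset {c : Compartment} (hc : c.IsAdmissible)
    {a : Fin N → Fin N → ℝ} (ha : ∀ i j, a i j = a j i) {b₁ b₂ : ℝ} (hb₁ : 0 ≤ b₁)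
    {x : ℝ → Fin N → ℝ × ℝ} (hx : IsIntegralCurveOn x (fun _ => c.networkField a) (Ici 0))
    (hmem : ∀ t, 0 ≤ t → x t ∈ boxN N b₁ b₂) :
    omegaLimitSet x ⊆ c.equilibria a ∩ boxN N b₁ b₂ := by
  intro p hp
  have hpB := mem_of_mem_omegaLimitSet (isCompact_boxN b₁ b₂).isClosed hmem hp
  refine ⟨⟨boxN_subset_Ici hpB, ?_⟩, hpB⟩
  obtain ⟨K, hF⟩ := hc.exists_lipschitzOnWith_networkField a
  -- Along an ultrafilter on which `x` tends to `p`, the field tends both to its value at `p` and to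
  -- `0`.
  obtain ⟨U, hU, hUp⟩ := mapClusterPt_iff_ultrafilter.1 hp
  have h₁ := (hc.tendsto_networkField_zero ha hb₁ hx hmem).mono_left hU
  have h₂ : Tendsto (fun t => c.networkField a (x t)) U (𝓝 (c.networkField a p)) :=
    (hF.continuousOn p (boxN_subset_Ici hpB)).tendsto.comp (tendsto_nhdsWithin_iff.2
      ⟨hUp, hU ((eventually_ge_atTop 0).mono fun t ht => boxN_subset_Ici (hmem t ht))⟩)
  exact tendsto_nhds_unique h₂ h₁

end Energy

end BistableNetwork

theorem mainTheorem1 (c : BistableNetwork.Compartment) (hc : c.IsAdmissible)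
    (N : ℕ) (a : Fin N → Fin N → ℝ) (ha_nonneg : ∀ i j, 0 ≤ a i j)
    (ha_symm : ∀ i j, a i j = a j i)
    (b₁ b₂ : ℝ) (hb₁ : 0 ≤ b₁) (hb₂ : 0 ≤ b₂)
    (hB : BistableNetwork.ForwardInvariant c.field (Set.Ici 0) (BistableNetwork.box b₁ b₂)) :
    ∀ ξ ∈ BistableNetwork.boxN N b₁ b₂,
      ∃ x : ℝ → Fin N → ℝ × ℝ,
        BistableNetwork.IsSolution (c.networkField a) (Set.Ici 0) ξ x ∧
        (∀ y : ℝ → Fin N → ℝ × ℝ,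
          BistableNetwork.IsSolution (c.networkField a) (Set.Ici 0) ξ y →
            Set.EqOn y x (Set.Ici 0)) ∧
        (∀ t : ℝ, 0 ≤ t → x t ∈ BistableNetwork.boxN N b₁ b₂) ∧
        BistableNetwork.omegaLimitSet x ⊆ c.equilibria a ∧
        (IsDiscrete (c.equilibria a ∩ BistableNetwork.boxN N b₁ b₂) →
          ∃ p ∈ c.equilibria a, Filter.Tendsto x Filter.atTop (𝓝 p)) := by
  intro ξ hξ
  obtain ⟨h₁, h₂⟩ := hc.inward_of_forwardInvariant hb₁ hb₂ hB
  obtain ⟨x, hx, hmem⟩ := hc.exists_isSolution_mem_boxN ha_nonneg hb₁ hb₂ h₁ h₂ hξ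
  obtain ⟨K, hF⟩ := hc.exists_lipschitzOnWith_networkField a
  have hω := hc.omegaLimitSet_subset ha_symm hb₁ hx.ode hmem
  refine ⟨x, hx, fun y hy => BistableNetwork.eqOn_Ici_of_isIntegralCurveOn hF hy.ode hy.mem hx.ode
    hx.mem (hy.init.trans hx.init.symm), hmem, hω.trans inter_subset_left, fun hdisc => ?_⟩
  obtain ⟨p, hp, hlim⟩ := BistableNetwork.tendsto_of_isDiscrete_omegaLimitSet
    (BistableNetwork.isCompact_boxN b₁ b₂) hdisc hx.ode.continuousOn hmem hω
  exact ⟨p, hp.1, hlim⟩
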